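/- Let $P\subset\mathbb{R}^n$ be a simple $d$-polytope, i.e. the convex hull of a finite set of points whose affine hull has dimension $d$, such that every vertex of $P$ lies on exactly $d$ edges. Let $G(P)$ be the graph formed by the vertices and edges of $P$, and let $2\le k\le d-1$. A *$k$-frame* of $P$ is a (not necessarily induced) subgraph of $G(P)$ isomorphic to the star $K_{1,k}$. A *$k$-system* of $G(P)$ is a set $\mathcal{S}$ of non-empty subsets of the vertex set of $P$ such that for every $S\in\mathcal{S}$ the subgraph of $G(P)$ induced by $S$ is $k$-regular, and such that the node set of every $k$-frame of $P$ is contained in exactly one set from $\mathcal{S}$. Let $\mathcal{V}_k(P)$ be the set of vertex sets of the $k$-dimensional faces of $P$. Then a $k$-system $\mathcal{S}$ of $G(P)$ equals $\mathcal{V}_k(P)$ if and only if $|\mathcal{S}|\ge|\mathcal{S}'|$ for every $k$-system $\mathcal{S}'$ of $G(P)$. -/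

import Mathlib

namespace SimplePolytope

/-- A polytope in `ℝⁿ`: the convex hull of a finite set of points. -/
def IsPolytope {n : ℕ} (P : Set (EuclideanSpace ℝ (Fin n))) : Prop :=
  ∃ X : Set (EuclideanSpace ℝ (Fin n)), X.Finite ∧ P = convexHull ℝ X

/-- The dimension of a non-empty set in `ℝⁿ`: the dimension of its affine hull. -/
noncomputable def dim {n : ℕ} (F : Set (EuclideanSpace ℝ (Fin n))) : ℕ :=
  Module.finrank ℝ (vectorSpan ℝ F)

/-- `F` is a `k`-face of `P`: a non-empty set of the form `P ∩ {x | l x = c}`, where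
`l ≤ c` is valid on `P` (this is `IsExposed`; `l = 0` gives `P` itself), of dimension `k`. -/
def IsFace {n : ℕ} (P : Set (EuclideanSpace ℝ (Fin n))) (k : ℕ)
    (F : Set (EuclideanSpace ℝ (Fin n))) : Prop :=
  IsExposed ℝ P F ∧ F.Nonempty ∧ dim F = k

/-- The vertices of `P`: the points `v` such that `{v}` is a face of `P`. -/
abbrev Vertex {n : ℕ} (P : Set (EuclideanSpace ℝ (Fin n))) : Type :=
  ↥(P.exposedPoints ℝ)

/-- The graph of `P`: two distinct vertices are adjacent if the segment between them is
a face of `P`. -/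
def graph {n : ℕ} (P : Set (EuclideanSpace ℝ (Fin n))) : SimpleGraph (Vertex P) where
  Adj v w := v ≠ w ∧ IsExposed ℝ P (segment ℝ (v : EuclideanSpace ℝ (Fin n)) w)
  symm := ⟨fun v w h => ⟨h.1.symm, by rw [segment_symm]; exact h.2⟩⟩
  loopless := ⟨fun _ h => h.1 rfl⟩

/-- A graph is `k`-regular if every node has exactly `k` neighbours. -/
def IsRegular {V : Type*} (G : SimpleGraph V) (k : ℕ) : Prop :=
  ∀ v, (G.neighborSet v).encard = k

/-- A simple `d`-polytope: a polytope of dimension `d` each of whose vertices lies on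
exactly `d` edges. -/
structure IsSimplePolytope {n : ℕ} (d : ℕ) (P : Set (EuclideanSpace ℝ (Fin n))) :
    Prop where
  isPolytope : IsPolytope P
  nonempty : P.Nonempty
  dim_eq : dim P = d
  regular : IsRegular (graph P) d

/-- The set of vertex sets of the `k`-faces of `P`. -/
def faceVertexSets {n : ℕ} (P : Set (EuclideanSpace ℝ (Fin n))) (k : ℕ) :
    Set (Set (Vertex P)) :=
  {W | ∃ F, IsFace P k F ∧ W = {v : Vertex P | (v : EuclideanSpace ℝ (Fin n)) ∈ F}}

/-- A `k`-frame of a graph: a (not necessarily induced) subgraph isomorphic to the star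
`K_{1,k}`. -/
def IsFrame {V : Type*} (G : SimpleGraph V) (k : ℕ) (H : G.Subgraph) : Prop :=
  Nonempty (H.coe ≃g completeBipartiteGraph (Fin 1) (Fin k))

/-- A `k`-system of a graph: a set of non-empty node sets, each inducing a `k`-regular
subgraph, such that the node set of every `k`-frame is contained in exactly one of them. -/
structure IsSystem {V : Type*} (G : SimpleGraph V) (k : ℕ) (𝒮 : Set (Set V)) : Prop where
  nonempty : ∀ S ∈ 𝒮, S.Nonempty
  regular : ∀ S ∈ 𝒮, IsRegular (G.induce S) k
  frame : ∀ H : G.Subgraph, IsFrame G k H → ∃! S, S ∈ 𝒮 ∧ H.verts ⊆ S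

end SimplePolytope

namespace SimplePolytope

/-! ### Counting argument for `k`-systems of an abstract finite graph. -/

section Combinatorics

variable {V : Type*} {G : SimpleGraph V} {k : ℕ}

/-! Order the vertices by a linear functional `c` injective on them. Given a `k`-system, send each
member `S` to the `k`-face containing the top vertex of `S` and its `k` neighbours in `S`. That
vertex is a local, hence global, maximum on the face; so the face determines the top vertex and its
neighbours, and with them `S`. This injection (`IsObjective.exists_injOn`) bounds every `k`-system
by the number of `k`-faces.

If a system attains the bound, the injection is onto. For a face `W`, choose `c` smaller on `W` than
elsewhere: the `S` sent to `W` then lies inside `W` and contains its top, and regularity forces `S =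
W` (`IsObjective.eq_of_subset`). So every face belongs to the system.

The geometry rests on `IsPolytope.sub_mem_hull_edges`: the edges at a vertex span a cone containing
the polytope. Hence local maxima are global, and in a simple polytope, where these edges are
independent, any `k` of them determine a `k`-face. -/

theorem isRegular_induce_iff {S : Set V} :
    IsRegular (G.induce S) k ↔ ∀ v ∈ S, (G.neighborSet v ∩ S).encard = k := by
  have key : ∀ v : S, ((↑) : S → V) '' (G.induce S).neighborSet v = G.neighborSet v ∩ S := by
    intro v
    ext w
    simp only [Set.mem_image, SimpleGraph.mem_neighborSet, SimpleGraph.comap_adj, Set.mem_inter_iff,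
      Subtype.exists, Function.Embedding.subtype_apply, SimpleGraph.induce]
    constructor
    · rintro ⟨a, ha, h, rfl⟩
      exact ⟨h, ha⟩
    · rintro ⟨h, hw⟩
      exact ⟨w, hw, h, rfl⟩
  constructor
  · intro h v hv
    rw [← key ⟨v, hv⟩, Subtype.val_injective.encard_image]
    exact h ⟨v, hv⟩
  · intro h v
    rw [← Subtype.val_injective.encard_image, key v]
    exact h v v.2

/-- The star with centre `v` and leaves `I`, as a subgraph. -/
def starSubgraph (G : SimpleGraph V) (v : V) (I : Set V) (hI : I ⊆ G.neighborSet v) :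
    G.Subgraph where
  verts := insert v I
  Adj a b := (a = v ∧ b ∈ I) ∨ (b = v ∧ a ∈ I)
  adj_sub := by
    rintro a b (⟨rfl, h⟩ | ⟨rfl, h⟩)
    · exact hI h
    · exact (hI h).symm
  edge_vert := by
    rintro a b (⟨rfl, h⟩ | ⟨rfl, h⟩)
    · exact Set.mem_insert _ _
    · exact Set.mem_insert_of_mem _ h
  symm := ⟨fun a b h => h.symm⟩

theorem isFrame_starSubgraph {v : V} {I : Set V} (hI : I ⊆ G.neighborSet v)
    (hk : I.encard = k) : IsFrame G k (starSubgraph G v I hI) := by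
  have hfin : I.Finite := Set.finite_of_encard_eq_coe hk
  have hcard : Nat.card I = k := by
    rw [Nat.card_coe_set_eq, Set.ncard, hk, ENat.toNat_natCast]
  have := hfin.to_subtype
  let e : I ≃ Fin k := Finite.equivFinOfCardEq hcard
  have hv : ∀ i : I, (i : V) ≠ v := fun i h => (hI i.2).ne h.symm
  let f : Fin 1 ⊕ Fin k → (starSubgraph G v I hI).verts :=
    Sum.elim (fun _ => ⟨v, Set.mem_insert _ _⟩)
      (fun j => ⟨e.symm j, Set.mem_insert_of_mem _ (e.symm j).2⟩)
  have hf : Function.Bijective f := by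
    constructor
    · rintro (a | a) (b | b) h
      · rw [Subsingleton.elim a b]
      · exact absurd (congrArg Subtype.val h).symm (hv _)
      · exact absurd (congrArg Subtype.val h) (hv _)
      · have hab : (f (Sum.inr a) : V) = f (Sum.inr b) := by rw [h]
        rw [e.symm.injective (Subtype.ext hab)]
    · rintro ⟨x, rfl | hx⟩
      · exact ⟨Sum.inl 0, rfl⟩
      · exact ⟨Sum.inr (e ⟨x, hx⟩), Subtype.ext (by simp [f])⟩
  refine ⟨(RelIso.symm ⟨Equiv.ofBijective f hf, ?_⟩)⟩
  intro a b
  change (((f a : V) = v ∧ (f b : V) ∈ I) ∨ ((f b : V) = v ∧ (f a : V) ∈ I)) ↔ _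
  have hvI : v ∉ I := fun h => (hI h).ne rfl
  rcases a with a | a <;> rcases b with b | b <;> simp [f, hv, hvI]

theorem IsFrame.exists_verts_eq {H : G.Subgraph} (h : IsFrame G k H) :
    ∃ v, ∃ I ⊆ G.neighborSet v, I.encard = k ∧ H.verts = insert v I := by
  obtain ⟨φ⟩ := h
  have hinj : Function.Injective fun j : Fin k => (φ.symm (Sum.inr j) : V) := fun i j hij =>
    Sum.inr_injective (φ.symm.injective (Subtype.ext hij))
  refine ⟨φ.symm (Sum.inl 0), Set.range fun j : Fin k => (φ.symm (Sum.inr j) : V), ?_, ?_, ?_⟩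
  · rintro _ ⟨j, rfl⟩
    have : H.coe.Adj (φ.symm (Sum.inl 0)) (φ.symm (Sum.inr j)) := by
      rw [φ.symm.map_adj_iff]
      simp
    exact H.adj_sub this
  · rw [← Set.image_univ, hinj.encard_image]
    simp
  · ext x
    constructor
    · intro hx
      obtain ⟨y, hy⟩ := φ.symm.surjective ⟨x, hx⟩
      rcases y with a | j
      · left
        rw [← Subsingleton.elim a 0, hy]
      · exact Or.inr ⟨j, by simp only [hy]⟩
    · rintro (rfl | ⟨j, rfl⟩)
      · exact Subtype.coe_prop _
      · exact Subtype.coe_prop _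

/-- Being a `k`-system, in terms of neighbour sets. -/
theorem isSystem_iff {𝒮 : Set (Set V)} :
    IsSystem G k 𝒮 ↔ (∀ S ∈ 𝒮, S.Nonempty) ∧
      (∀ S ∈ 𝒮, ∀ v ∈ S, (G.neighborSet v ∩ S).encard = k) ∧
      ∀ v, ∀ I ⊆ G.neighborSet v, I.encard = k → ∃! S, S ∈ 𝒮 ∧ insert v I ⊆ S := by
  constructor
  · intro h
    exact ⟨h.nonempty, fun S hS => isRegular_induce_iff.1 (h.regular S hS), fun v I hI hk =>
      h.frame _ (isFrame_starSubgraph hI hk)⟩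
  · rintro ⟨h1, h2, h3⟩
    refine ⟨h1, fun S hS => isRegular_induce_iff.2 (h2 S hS), fun H hH => ?_⟩
    obtain ⟨v, I, hI, hk, hv⟩ := hH.exists_verts_eq
    rw [hv]
    exact h3 v I hI hk

/-- An injective function on the nodes each of whose local maxima on a member of `𝒱` is a
global maximum on that member. -/
structure IsObjective (G : SimpleGraph V) (𝒱 : Set (Set V)) (c : V → ℝ) : Prop where
  injective : Function.Injective c
  le_of_local : ∀ W ∈ 𝒱, ∀ v ∈ W, (∀ w ∈ G.neighborSet v ∩ W, c w ≤ c v) → ∀ u ∈ W, c u ≤ c v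

/-- An objective function for a `k`-system `𝒱` embeds every `k`-system `𝒮` into `𝒱`, so that
corresponding sets have the same top node with the same neighbours. -/
theorem IsObjective.exists_injOn [Finite V] {𝒱 𝒮 : Set (Set V)} {c : V → ℝ}
    (hc : IsObjective G 𝒱 c) (h𝒱 : IsSystem G k 𝒱) (h𝒮 : IsSystem G k 𝒮) :
    ∃ φ : Set V → Set V, Set.MapsTo φ 𝒮 𝒱 ∧ Set.InjOn φ 𝒮 ∧
      ∀ S ∈ 𝒮, ∃ v ∈ S, v ∈ φ S ∧ (∀ u ∈ S, c u ≤ c v) ∧ ∀ u ∈ φ S, c u ≤ c v := by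
  rw [isSystem_iff] at h𝒱 h𝒮
  obtain ⟨-, rV, fV⟩ := h𝒱
  obtain ⟨nS, rS, fS⟩ := h𝒮
  have main : ∀ S ∈ 𝒮, ∃ W ∈ 𝒱, ∃ v ∈ S, v ∈ W ∧ (∀ u ∈ S, c u ≤ c v) ∧
      (∀ u ∈ W, c u ≤ c v) ∧ G.neighborSet v ∩ W = G.neighborSet v ∩ S := by
    intro S hS
    obtain ⟨v, hv, hmax⟩ := S.exists_max_image c (Set.toFinite S) (nS S hS)
    obtain ⟨W, ⟨hW, hsub⟩, -⟩ := fV v _ Set.inter_subset_left (rS S hS v hv)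
    have hvW := hsub (Set.mem_insert _ _)
    have heq : G.neighborSet v ∩ S = G.neighborSet v ∩ W :=
      (Set.toFinite _).eq_of_subset_of_encard_le
        (fun x hx => ⟨hx.1, hsub (Set.mem_insert_of_mem _ hx)⟩)
        (by rw [rV W hW v hvW, rS S hS v hv])
    refine ⟨W, hW, v, hv, hvW, hmax, hc.le_of_local W hW v hvW fun w hw => ?_, heq.symm⟩
    rw [← heq] at hw
    exact hmax w hw.2
  rcases isEmpty_or_nonempty V with hV | hV
  · have h0 : ∀ S, S ∉ 𝒮 := fun S hS => hV.elim (nS S hS).some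
    exact ⟨id, fun S hS => (h0 S hS).elim, fun S hS => (h0 S hS).elim, fun S hS => (h0 S hS).elim⟩
  choose! φ hφ t htS htW hmaxS hmaxW hN using main
  refine ⟨φ, hφ, fun S hS T hT hST => ?_, fun S hS =>
    ⟨t S, htS S hS, htW S hS, hmaxS S hS, hmaxW S hS⟩⟩
  have ht : t S = t T := hc.injective <| le_antisymm
    (hmaxW T hT _ (hST ▸ htW S hS)) (hmaxW S hS _ (hST ▸ htW T hT))
  -- Both sets contain the frame formed by the common top node and its neighbours in the common
  -- image.
  refine (fS (t S) _ Set.inter_subset_left (rS S hS _ (htS S hS))).unique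
    ⟨hS, Set.insert_subset (htS S hS) Set.inter_subset_right⟩
    ⟨hT, Set.insert_subset (ht ▸ htS T hT) ?_⟩
  rw [← hN S hS, hST, ht, hN T hT]
  exact Set.inter_subset_right

theorem IsObjective.encard_le [Finite V] {𝒱 𝒮 : Set (Set V)} {c : V → ℝ}
    (hc : IsObjective G 𝒱 c) (h𝒱 : IsSystem G k 𝒱) (h𝒮 : IsSystem G k 𝒮) :
    𝒮.encard ≤ 𝒱.encard := by
  obtain ⟨φ, hφ, hinj, -⟩ := hc.exists_injOn h𝒱 h𝒮
  exact Set.encard_le_encard_of_injOn hφ hinj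

/-- A `k`-regular subset of a `k`-regular set that contains its top node is all of it. -/
theorem IsObjective.eq_of_subset [Finite V] {𝒱 : Set (Set V)} {c : V → ℝ}
    (hc : IsObjective G 𝒱 c) {S W : Set V} (hW : W ∈ 𝒱)
    (rS : ∀ v ∈ S, (G.neighborSet v ∩ S).encard = k)
    (rW : ∀ v ∈ W, (G.neighborSet v ∩ W).encard = k)
    (hSW : S ⊆ W) {v : V} (hvS : v ∈ S) (hv : ∀ u ∈ W, c u ≤ c v) : S = W := by
  refine hSW.antisymm ?_
  by_contra hne
  obtain ⟨x, hxW, hxS⟩ := Set.not_subset.1 hne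
  -- The highest missing node `u` is not the top of `W`, so it has a higher neighbour `w` in `W`,
  -- which lies in `S`. But `w` already has all its `W`-neighbours in `S`, including `u`.
  obtain ⟨u, ⟨huW, huS⟩, hmax⟩ :=
    (W \ S).exists_max_image c (Set.toFinite _) ⟨x, hxW, hxS⟩
  by_cases hloc : ∀ w ∈ G.neighborSet u ∩ W, c w ≤ c u
  · have : u = v :=
      hc.injective (le_antisymm (hv u huW) (hc.le_of_local W hW u huW hloc v (hSW hvS)))
    exact huS (this ▸ hvS)
  · push Not at hloc
    obtain ⟨w, ⟨hadj, hwW⟩, hlt⟩ := hloc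
    have hwS : w ∈ S := by
      by_contra hwS
      exact absurd (hmax w ⟨hwW, hwS⟩) (not_le.2 hlt)
    have heq : G.neighborSet w ∩ S = G.neighborSet w ∩ W :=
      (Set.toFinite _).eq_of_subset_of_encard_le (Set.inter_subset_inter_right _ hSW)
        (by rw [rS w hwS, rW w hwW])
    have : u ∈ G.neighborSet w ∩ W := ⟨hadj.symm, huW⟩
    rw [← heq] at this
    exact huS this.2

/-- A `k`-system with an objective function that has any given member as an initial set is the
unique `k`-system of maximal cardinality. -/
theorem eq_iff_forall_encard_le [Finite V] {𝒱 𝒮 : Set (Set V)}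
    (h𝒱 : IsSystem G k 𝒱) (h𝒮 : IsSystem G k 𝒮) (hc : ∃ c, IsObjective G 𝒱 c)
    (hinit : ∀ W ∈ 𝒱, ∃ c, IsObjective G 𝒱 c ∧ ∀ u ∈ W, ∀ w ∉ W, c u < c w) :
    𝒮 = 𝒱 ↔ ∀ 𝒯, IsSystem G k 𝒯 → 𝒯.encard ≤ 𝒮.encard := by
  constructor
  · rintro rfl 𝒯 h𝒯
    exact hc.choose_spec.encard_le h𝒱 h𝒯
  · intro h
    have hle := h 𝒱 h𝒱
    suffices hsub : 𝒱 ⊆ 𝒮 from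
      ((Set.toFinite 𝒱).eq_of_subset_of_encard_le hsub
        (hc.choose_spec.encard_le h𝒱 h𝒮)).symm
    intro W hW
    obtain ⟨c, hc, hcW⟩ := hinit W hW
    obtain ⟨φ, hφ, hinj, htop⟩ := hc.exists_injOn h𝒱 h𝒮
    have hsurj : φ '' 𝒮 = 𝒱 := (Set.toFinite _).eq_of_subset_of_encard_le hφ.image_subset
      (by rwa [hinj.encard_image])
    obtain ⟨S, hS, rfl⟩ : W ∈ φ '' 𝒮 := hsurj ▸ hW
    obtain ⟨v, hvS, hvW, hmaxS, hmaxW⟩ := htop S hS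
    have hsub : S ⊆ φ S := by
      intro u hu
      by_contra huW
      exact absurd (hmaxS u hu) (not_le.2 (hcW v hvW u huW))
    have := hc.eq_of_subset hW ((isSystem_iff.1 h𝒮).2.1 S hS)
      ((isSystem_iff.1 h𝒱).2.1 _ hW) hsub hvS hmaxW
    rwa [← this]

end Combinatorics


/-! ### Faces, edge cones and linear functionals of polytopes. -/

section Polytope

variable {n : ℕ} {P F : Set (EuclideanSpace ℝ (Fin n))}

theorem IsPolytope.isCompact (hP : IsPolytope P) : IsCompact P := by
  obtain ⟨X, hX, rfl⟩ := hP
  exact hX.isCompact_convexHull ℝ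

theorem IsPolytope.convex (hP : IsPolytope P) : Convex ℝ P := by
  obtain ⟨X, hX, rfl⟩ := hP
  exact convex_convexHull ℝ X

/-- An extreme point lies outside the hull of the other generators, which is closed since they are
finitely many; a functional strictly separating the two exposes it. -/
theorem IsPolytope.extremePoints_eq (hP : IsPolytope P) :
    P.extremePoints ℝ = P.exposedPoints ℝ := by
  refine Set.Subset.antisymm ?_ exposedPoints_subset_extremePoints
  obtain ⟨X, hX, rfl⟩ := hP
  intro x hx
  have hx' := ((convex_convexHull ℝ X).mem_extremePoints_iff_mem_sdiff_convexHull_sdiff.1 hx).2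
  have hnot : x ∉ convexHull ℝ (X \ {x}) := fun h =>
    hx' (convexHull_mono (Set.sdiff_subset_sdiff_left (subset_convexHull ℝ X)) h)
  obtain ⟨l, u, hlu, hux⟩ := geometric_hahn_banach_closed_point (convex_convexHull ℝ (X \ {x}))
    ((hX.subset Set.sdiff_subset).isClosed_convexHull ℝ) hnot
  refine ⟨hx.1, l, fun y hy => ?_⟩
  have hins : X ⊆ insert x (X \ {x}) := fun z hz => by
    by_cases h : z = x
    · exact Or.inl h
    · exact Or.inr ⟨hz, h⟩
  rcases (X \ {x}).eq_empty_or_nonempty with h0 | hne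
  · have hy' := convexHull_mono hins hy
    rw [h0, insert_empty_eq, convexHull_singleton] at hy'
    rw [Set.mem_singleton_iff.1 hy']
    exact ⟨le_rfl, fun _ => rfl⟩
  · have hy' := convexHull_mono hins hy
    rw [convexHull_insert hne, mem_convexJoin] at hy'
    obtain ⟨a, ha, z, hz, s, t, hs, ht, hst, rfl⟩ := hy'
    rw [Set.mem_singleton_iff.1 ha]
    have hz' := hlu z hz
    have hs' : s = 1 - t := by linarith
    subst hs'
    simp only [map_add, map_smul, smul_eq_mul]
    constructor
    · nlinarith
    · intro h
      have : t = 0 := by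
        by_contra ht0
        have : 0 < t := lt_of_le_of_ne ht (Ne.symm ht0)
        nlinarith
      subst this
      simp

theorem IsPolytope.finite_exposedPoints (hP : IsPolytope P) : (P.exposedPoints ℝ).Finite := by
  obtain ⟨X, hX, rfl⟩ := hP
  exact hX.subset (exposedPoints_subset_extremePoints.trans extremePoints_convexHull_subset)

theorem IsPolytope.finite_vertex (hP : IsPolytope P) : Finite (Vertex P) :=
  hP.finite_exposedPoints.to_subtype

/-- An exposed subset of a polytope is the convex hull of the vertices it contains. -/
theorem IsPolytope.convexHull_inter_exposedPoints (hP : IsPolytope P) (hF : IsExposed ℝ P F) :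
    convexHull ℝ (F ∩ P.exposedPoints ℝ) = F := by
  have h1 := closure_convexHull_extremePoints (hF.isCompact hP.isCompact) (hF.convex hP.convex)
  rwa [hF.isExtreme.extremePoints_eq, hP.extremePoints_eq,
    ((hP.finite_exposedPoints.subset Set.inter_subset_right).isClosed_convexHull ℝ).closure_eq] at h1

theorem IsPolytope.convexHull_exposedPoints (hP : IsPolytope P) :
    convexHull ℝ (P.exposedPoints ℝ) = P := by
  have := hP.convexHull_inter_exposedPoints (IsExposed.refl P)
  rwa [Set.inter_eq_right.2 exposedPoints_subset] at this

theorem IsPolytope.exists_vertex_mem (hP : IsPolytope P) (hF : IsExposed ℝ P F)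
    (hne : F.Nonempty) : ∃ v : Vertex P, (v : EuclideanSpace ℝ (Fin n)) ∈ F := by
  rw [← hP.convexHull_inter_exposedPoints hF, convexHull_nonempty_iff] at hne
  obtain ⟨v, hv, hv'⟩ := hne
  exact ⟨⟨v, hv'⟩, hv⟩

/-- An upper bound for a functional on the vertices of a polytope holds on the polytope. -/
theorem IsPolytope.le_of_forall_vertex (hP : IsPolytope P)
    (g : StrongDual ℝ (EuclideanSpace ℝ (Fin n))) {m : ℝ}
    (hg : ∀ x ∈ P.exposedPoints ℝ, g x ≤ m) {x : EuclideanSpace ℝ (Fin n)} (hx : x ∈ P) :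
    g x ≤ m := by
  rw [← hP.convexHull_exposedPoints] at hx
  exact convexHull_min (t := {x | g x ≤ m}) hg
    (convex_halfSpace_le g.toLinearMap.isLinear m) hx

/-- A polytope is contained in the cone spanned by the edges at any of its vertices. -/
theorem IsPolytope.sub_mem_hull_edges (hP : IsPolytope P) (v : Vertex P)
    {x : EuclideanSpace ℝ (Fin n)} (hx : x ∈ P) :
    x - v ∈ PointedCone.hull ℝ
      (Set.range fun w : (graph P).neighborSet v => (w : EuclideanSpace ℝ (Fin n)) - v) := by
  set C := PointedCone.hull ℝ
    (Set.range fun w : (graph P).neighborSet v => (w : EuclideanSpace ℝ (Fin n)) - v) with hC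
  obtain ⟨hvP, l, hl⟩ := v.2
  set X := P.exposedPoints ℝ with hX
  have hXP : X ⊆ P := exposedPoints_subset
  have hpos : ∀ x ∈ X, x ≠ v → 0 < l v - l x := fun x hx hxv =>
    sub_pos.2 (lt_of_not_ge fun h => hxv ((hl x (hXP hx)).2 h))
  -- Central projection from `v`, taken as origin, onto the hyperplane `l = -1`. The hull of the
  -- images is a vertex figure, whose vertices turn out to be edge directions.
  let y : EuclideanSpace ℝ (Fin n) → EuclideanSpace ℝ (Fin n) := fun x =>
    (l v - l x)⁻¹ • (x - v)
  have hy : ∀ x ∈ X, x ≠ v → x - v = (l v - l x) • y x := fun x hx hxv =>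
    (smul_inv_smul₀ (hpos x hx hxv).ne' _).symm
  have hly : ∀ x ∈ X, x ≠ v → l (y x) = -1 := by
    intro x hx hxv
    have := (hpos x hx hxv).ne'
    simp only [y, map_smul, map_sub, smul_eq_mul]
    rw [← neg_sub (l v) (l x), mul_neg, inv_mul_cancel₀ this]
  have hQ : IsPolytope (convexHull ℝ (y '' (X \ {(v : EuclideanSpace ℝ (Fin n))}))) :=
    ⟨_, (hP.finite_exposedPoints.subset Set.sdiff_subset).image y, rfl⟩
  have hedge : (convexHull ℝ (y '' (X \ {(v : EuclideanSpace ℝ (Fin n))}))).exposedPoints ℝ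
      ⊆ C := by
    intro p hp
    obtain ⟨x₀, ⟨hx₀, hx₀v⟩, hyx₀⟩ :=
      extremePoints_convexHull_subset (exposedPoints_subset_extremePoints hp)
    obtain ⟨-, h, hh⟩ := hp
    rw [Set.mem_singleton_iff] at hx₀v
    have hlp : l p = -1 := hyx₀ ▸ hly x₀ hx₀ hx₀v
    -- Since `l p = -1`, this `g` vanishes at `p`; it exposes a face whose vertices other than `v`
    -- all project to `p`.
    let g : StrongDual ℝ (EuclideanSpace ℝ (Fin n)) := h + h p • l
    have hgy : ∀ x ∈ X, x ≠ v → g x - g v = (l v - l x) * (h (y x) - h p) := by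
      intro x hx hxv
      rw [← map_sub, hy x hx hxv, map_smul, smul_eq_mul]
      simp only [g, add_apply, smul_apply, smul_eq_mul,
        hly x hx hxv]
      ring
    have hhy : ∀ x ∈ X, x ≠ v → h (y x) ≤ h p ∧ (h p ≤ h (y x) → y x = p) := fun x hx hxv =>
      hh _ (subset_convexHull ℝ _ ⟨x, ⟨hx, hxv⟩, rfl⟩)
    have hgX : ∀ x ∈ X, g x ≤ g v := by
      intro x hx
      by_cases hxv : x = v
      · rw [hxv]
      · have := mul_nonpos_of_nonneg_of_nonpos (hpos x hx hxv).le
          (sub_nonpos.2 (hhy x hx hxv).1)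
        linarith [hgy x hx hxv]
    have hgP : ∀ x ∈ P, g x ≤ g v := fun x hx => hP.le_of_forall_vertex g hgX hx
    have hF : IsExposed ℝ P (g.toExposed P) := ContinuousLinearMap.toExposed.isExposed
    have hFmem : ∀ x, x ∈ g.toExposed P ↔ x ∈ P ∧ g x = g v := fun x =>
      ⟨fun hx => ⟨hx.1, le_antisymm (hgP x hx.1) (hx.2 v hvP)⟩,
        fun hx => ⟨hx.1, fun z hz => hx.2 ▸ hgP z hz⟩⟩
    have hFX : ∀ x ∈ X, x ∈ g.toExposed P → x ≠ v → y x = p := by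
      intro x hx hxF hxv
      have h1 := hgy x hx hxv
      rw [((hFmem x).1 hxF).2, sub_self, eq_comm, mul_eq_zero] at h1
      exact (hhy x hx hxv).2 (by
        rcases h1 with h1 | h1
        · exact absurd h1 (hpos x hx hxv).ne'
        · linarith)
    have hx₀F : x₀ ∈ g.toExposed P := (hFmem x₀).2 ⟨hXP hx₀, by
      have := hgy x₀ hx₀ hx₀v
      rw [hyx₀, sub_self, mul_zero] at this
      linarith⟩
    have hvF : (v : EuclideanSpace ℝ (Fin n)) ∈ g.toExposed P := (hFmem _).2 ⟨hvP, rfl⟩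
    -- The vertices of this face lie on one ray from `v`; the farthest is the other end of the edge.
    obtain ⟨w, ⟨hwF, hwX⟩, hmin⟩ := (g.toExposed P ∩ X).exists_min_image l
      (hP.finite_exposedPoints.subset Set.inter_subset_right) ⟨x₀, hx₀F, hx₀⟩
    have hwv : w ≠ v := by
      rintro rfl
      have := hmin x₀ ⟨hx₀F, hx₀⟩
      linarith [hpos x₀ hx₀ hx₀v]
    have hwp := hpos w hwX hwv
    have hw := hy w hwX hwv
    rw [hFX w hwX hwF hwv] at hw
    have hseg : g.toExposed P = segment ℝ (v : EuclideanSpace ℝ (Fin n)) w := by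
      refine Set.Subset.antisymm ?_ ((hF.convex hP.convex).segment_subset hvF hwF)
      rw [← hP.convexHull_inter_exposedPoints hF]
      refine convexHull_min ?_ (convex_segment _ _)
      rintro x ⟨hxF, hx⟩
      by_cases hxv : x = v
      · rw [hxv]
        exact left_mem_segment ℝ _ _
      · have hxe := hy x hx hxv
        rw [hFX x hx hxF hxv] at hxe
        rw [segment_eq_image']
        refine ⟨(l v - l x) / (l v - l w), ⟨div_nonneg (hpos x hx hxv).le hwp.le,
          (div_le_one hwp).2 (by linarith [hmin x ⟨hxF, hx⟩])⟩, ?_⟩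
        simp only
        rw [hw, smul_smul, div_mul_cancel₀ _ hwp.ne', ← hxe]
        abel
    have hadj : (graph P).Adj v ⟨w, hwX⟩ :=
      ⟨fun h => hwv (congrArg Subtype.val h).symm, hseg ▸ hF⟩
    have hpw : p = (l v - l w)⁻¹ • (w - v) := by
      rw [hw, inv_smul_smul₀ hwp.ne']
    rw [hpw]
    exact C.smul_mem (inv_nonneg.2 hwp.le) (Submodule.subset_span ⟨⟨⟨w, hwX⟩, hadj⟩, rfl⟩)
  have hQC := convexHull_min hedge C.convex
  rw [hQ.convexHull_exposedPoints] at hQC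
  rw [← hP.convexHull_exposedPoints] at hx
  have hconv : Convex ℝ {x : EuclideanSpace ℝ (Fin n) | x - v ∈ C} := by
    simpa [Set.preimage, sub_eq_add_neg] using
      C.convex.translate_preimage_left (-(v : EuclideanSpace ℝ (Fin n)))
  refine convexHull_min (fun x hx => ?_) hconv hx
  by_cases hxv : x = v
  · simp [hxv]
  · change x - v ∈ C
    rw [hy x hx hxv]
    exact C.smul_mem (hpos x hx hxv).le (hQC (subset_convexHull ℝ _ ⟨x, ⟨hx, hxv⟩, rfl⟩))

/-- A point of a face is a non-negative combination of the edges of the face at a vertex. -/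
theorem IsPolytope.exists_nonneg_of_mem_face (hP : IsPolytope P) (hF : IsExposed ℝ P F)
    [Fintype (Vertex P)] {v : Vertex P} (hv : (v : EuclideanSpace ℝ (Fin n)) ∈ F)
    {x : EuclideanSpace ℝ (Fin n)} (hx : x ∈ F) :
    ∃ t : Vertex P → ℝ, (∀ w, 0 ≤ t w) ∧
      (∀ w, t w ≠ 0 → (graph P).Adj v w ∧ (w : EuclideanSpace ℝ (Fin n)) ∈ F) ∧
      x - v = ∑ w, t w • ((w : EuclideanSpace ℝ (Fin n)) - v) := by
  classical
  have h := hP.sub_mem_hull_edges v (hF.subset hx)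
  rw [PointedCone.hull, Submodule.mem_span_range_iff_exists_fun] at h
  obtain ⟨c, hc⟩ := h
  let t : Vertex P → ℝ := fun w => if hw : (graph P).Adj v w then (c ⟨w, hw⟩ : ℝ) else 0
  have ht0 : ∀ w, 0 ≤ t w := by
    intro w
    by_cases hw : (graph P).Adj v w
    · simp only [t, dif_pos hw]
      exact (c ⟨w, hw⟩).2
    · simp [t, hw]
  have htadj : ∀ w, t w ≠ 0 → (graph P).Adj v w := by
    intro w
    contrapose
    intro hw
    simp [t, hw]
  have hsum : x - v = ∑ w, t w • ((w : EuclideanSpace ℝ (Fin n)) - v) := by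
    rw [← hc, ← Finset.sum_subset (Finset.subset_univ (Finset.univ.filter ((graph P).Adj v)))]
    · rw [Finset.sum_subtype (p := fun w => w ∈ (graph P).neighborSet v) _ (by simp)]
      refine Finset.sum_congr rfl fun w _ => ?_
      have hw : (graph P).Adj v w := w.2
      simp only [t, dif_pos hw]
      rfl
    · intro w _ hw
      rw [Finset.mem_filter] at hw
      have : ¬ (graph P).Adj v w := fun h => hw ⟨Finset.mem_univ _, h⟩
      simp [t, this]
  refine ⟨t, ht0, fun w hw => ⟨htadj w hw, ?_⟩, hsum⟩
  obtain ⟨l, rfl⟩ := hF ⟨x, hx⟩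
  have hl : l x - l v = ∑ w, t w * (l w - l v) := by
    rw [← map_sub, hsum, map_sum]
    simp
  have hxv : l x - l v = 0 := sub_eq_zero.2 (le_antisymm (hv.2 x hx.1) (hx.2 v hv.1))
  have hle : ∀ w : Vertex P, l w ≤ l v := fun w => hv.2 w (exposedPoints_subset w.2)
  rw [hxv, eq_comm, Finset.sum_eq_zero_iff_of_nonpos
    (fun w _ => mul_nonpos_of_nonneg_of_nonpos (ht0 w) (sub_nonpos.2 (hle w)))] at hl
  have h0 : l w = l v := by
    rcases mul_eq_zero.1 (hl w (Finset.mem_univ w)) with h | h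
    · exact absurd h hw
    · linarith
  exact ⟨exposedPoints_subset w.2, fun z hz => h0 ▸ hv.2 z hz⟩

/-- A face is cut out by the span of its edges at a vertex. -/
theorem IsPolytope.mem_face_iff (hP : IsPolytope P) (hF : IsExposed ℝ P F) {v : Vertex P}
    (hv : (v : EuclideanSpace ℝ (Fin n)) ∈ F) {x : EuclideanSpace ℝ (Fin n)} :
    x ∈ F ↔ x ∈ P ∧ x - v ∈ Submodule.span ℝ
      ((fun w : Vertex P => (w : EuclideanSpace ℝ (Fin n)) - v) ''
        ((graph P).neighborSet v ∩ {w | (w : EuclideanSpace ℝ (Fin n)) ∈ F})) := by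
  have := hP.finite_vertex
  have := Fintype.ofFinite (Vertex P)
  constructor
  · intro hx
    refine ⟨hF.subset hx, ?_⟩
    obtain ⟨t, -, ht, hsum⟩ := hP.exists_nonneg_of_mem_face hF hv hx
    rw [hsum]
    refine Submodule.sum_mem _ fun w _ => ?_
    by_cases h : t w = 0
    · simp [h]
    · exact Submodule.smul_mem _ _ (Submodule.subset_span ⟨w, ht w h, rfl⟩)
  · rintro ⟨hxP, hx⟩
    obtain ⟨l, rfl⟩ := hF ⟨v, hv⟩
    have hker : x - v ∈ LinearMap.ker l.toLinearMap := by
      refine (Submodule.span_le.2 ?_) hx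
      rintro _ ⟨w, ⟨-, hw⟩, rfl⟩
      have : l w = l v := le_antisymm (hv.2 w hw.1) (hw.2 v hv.1)
      simp [this]
    have h0 : l x = l v := by simpa [sub_eq_zero] using hker
    exact ⟨hxP, fun z hz => h0 ▸ hv.2 z hz⟩

theorem IsPolytope.vectorSpan_face (hP : IsPolytope P) (hF : IsExposed ℝ P F) {v : Vertex P}
    (hv : (v : EuclideanSpace ℝ (Fin n)) ∈ F) :
    vectorSpan ℝ F = Submodule.span ℝ
      ((fun w : Vertex P => (w : EuclideanSpace ℝ (Fin n)) - v) ''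
        ((graph P).neighborSet v ∩ {w | (w : EuclideanSpace ℝ (Fin n)) ∈ F})) := by
  rw [vectorSpan_eq_span_vsub_set_right ℝ hv]
  refine le_antisymm (Submodule.span_le.2 ?_) (Submodule.span_mono ?_)
  · rintro _ ⟨x, hx, rfl⟩
    exact ((hP.mem_face_iff hF hv).1 hx).2
  · rintro _ ⟨w, ⟨-, hw⟩, rfl⟩
    exact ⟨w, hw, rfl⟩

/-! ### Simple polytopes, their face system, and objective functions. -/

variable {d k : ℕ}

/-- The edges at a vertex of a simple polytope are linearly independent. -/
theorem IsSimplePolytope.linearIndepOn_edges (hP : IsSimplePolytope d P) (v : Vertex P) :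
    LinearIndepOn ℝ (fun w : Vertex P => (w : EuclideanSpace ℝ (Fin n)) - v)
      ((graph P).neighborSet v) := by
  have := hP.isPolytope.finite_vertex
  have := Fintype.ofFinite ((graph P).neighborSet v)
  -- The `d` edges at `v` span the `d`-dimensional direction of `P`.
  rw [LinearIndepOn, linearIndependent_iff_card_le_finrank_span, Set.finrank]
  have hvP := exposedPoints_subset v.2
  have hspan := hP.isPolytope.vectorSpan_face (IsExposed.refl P) hvP
  have hdim := hP.dim_eq
  have hN : (graph P).neighborSet v ∩ {w | (w : EuclideanSpace ℝ (Fin n)) ∈ P} =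
      (graph P).neighborSet v :=
    Set.inter_eq_left.2 fun w _ => show (w : EuclideanSpace ℝ (Fin n)) ∈ P from
      exposedPoints_subset w.2
  rw [dim, hspan, hN, Set.image_eq_range] at hdim
  rw [hdim]
  have hreg := hP.regular v
  rw [Set.encard_eq_coe_toFinset_card, Set.toFinset_card] at hreg
  exact_mod_cast hreg.le

theorem IsSimplePolytope.encard_neighborSet_inter (hP : IsSimplePolytope d P)
    (hF : IsExposed ℝ P F) {v : Vertex P} (hv : (v : EuclideanSpace ℝ (Fin n)) ∈ F) :
    ((graph P).neighborSet v ∩ {w | (w : EuclideanSpace ℝ (Fin n)) ∈ F}).encard = dim F := by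
  have := hP.isPolytope.finite_vertex
  set N := (graph P).neighborSet v ∩ {w | (w : EuclideanSpace ℝ (Fin n)) ∈ F}
  have := Fintype.ofFinite N
  have hli := (hP.linearIndepOn_edges v).mono (t := N) Set.inter_subset_left
  rw [dim, hP.isPolytope.vectorSpan_face hF hv, Set.image_eq_range]
  rw [finrank_span_eq_card hli, Set.encard_eq_coe_toFinset_card, Set.toFinset_card]

/-- Any set of edges at a vertex of a simple polytope is the set of edges of a face. -/
theorem IsSimplePolytope.exists_face (hP : IsSimplePolytope d P) (v : Vertex P)
    {I : Set (Vertex P)} (hI : I ⊆ (graph P).neighborSet v) :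
    ∃ F, IsExposed ℝ P F ∧ (v : EuclideanSpace ℝ (Fin n)) ∈ F ∧
      (graph P).neighborSet v ∩ {w | (w : EuclideanSpace ℝ (Fin n)) ∈ F} = I := by
  classical
  have := hP.isPolytope.finite_vertex
  have := Fintype.ofFinite (Vertex P)
  have hvP := exposedPoints_subset v.2
  have hli : LinearIndependent ℝ fun w : (graph P).neighborSet v =>
    (w : EuclideanSpace ℝ (Fin n)) - v := hP.linearIndepOn_edges v
  -- Independence allows prescribing `0` on the edges in `I` and `-1` on the others; on the edge
  -- cone this is at most `0`.
  obtain ⟨f, hf⟩ := LinearMap.exists_extend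
    ((Module.Basis.span hli).constr ℝ fun w => if (w : Vertex P) ∈ I then (0 : ℝ) else -1)
  have hfw : ∀ w, (graph P).Adj v w →
      f ((w : EuclideanSpace ℝ (Fin n)) - v) = if w ∈ I then (0 : ℝ) else -1 := by
    intro w hw
    have h1 := LinearMap.congr_fun hf (Module.Basis.span hli ⟨w, hw⟩)
    rw [Module.Basis.constr_basis] at h1
    simpa [Module.Basis.span_apply] using h1
  let g : StrongDual ℝ (EuclideanSpace ℝ (Fin n)) := LinearMap.toContinuousLinearMap f
  have hg : ∀ x, g x = f x := fun x => rfl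
  have hgv : ∀ x ∈ P, g x ≤ g v := by
    intro x hx
    obtain ⟨t, ht, hadj, hsum⟩ :=
      hP.isPolytope.exists_nonneg_of_mem_face (IsExposed.refl P) hvP hx
    rw [← sub_nonpos, ← map_sub, hsum, map_sum]
    refine Finset.sum_nonpos fun w _ => ?_
    by_cases h : t w = 0
    · simp [h]
    · rw [map_smul, smul_eq_mul, hg, hfw w (hadj w h).1]
      refine mul_nonpos_of_nonneg_of_nonpos (ht w) ?_
      split_ifs <;> norm_num
  refine ⟨g.toExposed P, ContinuousLinearMap.toExposed.isExposed, ⟨hvP, hgv⟩, ?_⟩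
  have key : ∀ w, (graph P).Adj v w →
      ((w : EuclideanSpace ℝ (Fin n)) ∈ g.toExposed P ↔ w ∈ I) := by
    intro w hw
    have h1 := hfw w hw
    rw [← hg, map_sub] at h1
    constructor
    · intro h
      by_contra hwI
      rw [if_neg hwI] at h1
      linarith [h.2 v hvP]
    · intro hwI
      rw [if_pos hwI] at h1
      have h2 : g w = g v := by linarith
      exact ⟨exposedPoints_subset w.2, fun z hz => h2 ▸ hgv z hz⟩
  ext w
  exact ⟨fun h => (key w h.1).1 h.2, fun h => ⟨hI h, (key w (hI h)).2 h⟩⟩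

/-- The vertex sets of the `k`-faces of a simple polytope form a `k`-system. -/
theorem IsSimplePolytope.isSystem_faceVertexSets (hP : IsSimplePolytope d P) :
    IsSystem (graph P) k (faceVertexSets P k) := by
  have := hP.isPolytope.finite_vertex
  rw [isSystem_iff]
  refine ⟨?_, ?_, ?_⟩
  · rintro _ ⟨F, ⟨hF, hne, -⟩, rfl⟩
    exact hP.isPolytope.exists_vertex_mem hF hne
  · rintro _ ⟨F, ⟨hF, -, rfl⟩, rfl⟩ v hv
    exact hP.encard_neighborSet_inter hF hv
  · intro v I hI hk
    obtain ⟨F, hF, hvF, hFI⟩ := hP.exists_face v hI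
    have hdim : dim F = k := by
      have := hP.encard_neighborSet_inter hF hvF
      rw [hFI, hk] at this
      exact_mod_cast this.symm
    refine ⟨_, ⟨⟨F, ⟨hF, ⟨v, hvF⟩, hdim⟩, rfl⟩, Set.insert_subset hvF
      (hFI ▸ Set.inter_subset_right)⟩, ?_⟩
    rintro _ ⟨⟨F', ⟨hF', -, hdim'⟩, rfl⟩, hsub⟩
    have hvF' := hsub (Set.mem_insert _ _)
    -- Equal cardinality leaves no further edges, so both faces are cut out by the same span.
    have hI' : I = (graph P).neighborSet v ∩ {w | (w : EuclideanSpace ℝ (Fin n)) ∈ F'} :=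
      (Set.toFinite _).eq_of_subset_of_encard_le
        (Set.subset_inter hI ((Set.subset_insert _ _).trans hsub))
        (by rw [hP.encard_neighborSet_inter hF' hvF', hdim', hk])
    have : F' = F := by
      ext x
      rw [hP.isPolytope.mem_face_iff hF' hvF', hP.isPolytope.mem_face_iff hF hvF, hFI, ← hI']
    rw [this]

/-- A linear functional that is injective on the vertices is an objective function. -/
theorem IsPolytope.isObjective (hP : IsPolytope P)
    (c : StrongDual ℝ (EuclideanSpace ℝ (Fin n)))
    (hc : Function.Injective fun v : Vertex P => c v) :
    IsObjective (graph P) (faceVertexSets P k) fun v => c v := by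
  refine ⟨hc, ?_⟩
  rintro _ ⟨F, ⟨hF, -, -⟩, rfl⟩ v hv hloc u hu
  have := hP.finite_vertex
  have := Fintype.ofFinite (Vertex P)
  obtain ⟨t, ht, hadj, hsum⟩ := hP.exists_nonneg_of_mem_face hF hv hu
  rw [← sub_nonpos, ← map_sub, hsum, map_sum]
  refine Finset.sum_nonpos fun w _ => ?_
  by_cases h : t w = 0
  · simp [h]
  · rw [map_smul, smul_eq_mul, map_sub]
    exact mul_nonpos_of_nonneg_of_nonpos (ht w) (sub_nonpos.2 (hloc w (hadj w h)))

theorem IsPolytope.exists_injective (hP : IsPolytope P) :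
    ∃ c : StrongDual ℝ (EuclideanSpace ℝ (Fin n)), Function.Injective fun v : Vertex P => c v := by
  have := hP.finite_vertex
  obtain ⟨f, hf⟩ := Module.exists_dual_forall_apply_ne_zero (K := ℝ)
    (fun p : {p : Vertex P × Vertex P // p.1 ≠ p.2} =>
      (p.1.1 : EuclideanSpace ℝ (Fin n)) - p.1.2)
    (fun p => sub_ne_zero.2 fun h => p.2 (Subtype.ext h))
  refine ⟨LinearMap.toContinuousLinearMap f, fun u v huv => ?_⟩
  by_contra hne
  refine hf ⟨(u, v), hne⟩ ?_
  rw [map_sub]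
  exact sub_eq_zero.2 huv

/-- For every face there is a linear functional, injective on the vertices, whose values on the
face are smaller than those on all other vertices. -/
theorem IsPolytope.exists_injective_initial (hP : IsPolytope P) (hF : IsExposed ℝ P F)
    (hne : F.Nonempty) :
    ∃ c : StrongDual ℝ (EuclideanSpace ℝ (Fin n)), (Function.Injective fun v : Vertex P => c v) ∧
      ∀ u w : Vertex P, (u : EuclideanSpace ℝ (Fin n)) ∈ F →
        (w : EuclideanSpace ℝ (Fin n)) ∉ F → c u < c w := by
  have := hP.finite_vertex
  obtain ⟨g, hg⟩ := hP.exists_injective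
  obtain ⟨l, rfl⟩ := hF hne
  -- As `F` maximises `l`, subtracting a large multiple of `l` from `g` puts `F` lowest, while `g`
  -- breaks ties.
  have hev : ∀ p : Vertex P × Vertex P, ∀ᶠ M : ℝ in Filter.atTop,
      l p.2 < l p.1 → g p.1 - M * l p.1 < g p.2 - M * l p.2 := by
    rintro ⟨u, w⟩
    filter_upwards [Filter.eventually_gt_atTop ((g u - g w) / (l u - l w))] with M hM h
    rw [div_lt_iff₀ (sub_pos.2 h)] at hM
    linarith
  obtain ⟨M, hM⟩ := (Filter.eventually_all.2 hev).exists
  have hval : ∀ x, (g - M • l) x = g x - M * l x := fun x => rfl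
  refine ⟨g - M • l, fun u w huw => ?_, fun u w hu hw => ?_⟩
  · simp only [hval] at huw
    rcases lt_trichotomy (l u) (l w) with h | h | h
    · exact absurd huw (hM (w, u) h).ne'
    · rw [h] at huw
      exact hg (sub_left_injective huw)
    · exact absurd huw (hM (u, w) h).ne
  · rw [hval, hval]
    refine hM (u, w) (lt_of_not_ge fun h => hw ⟨exposedPoints_subset w.2, fun z hz =>
      (hu.2 z hz).trans h⟩)

end Polytope

end SimplePolytope

theorem mainTheorem4 {n : ℕ} (d k : ℕ) (P : Set (EuclideanSpace ℝ (Fin n)))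
    (hP : SimplePolytope.IsSimplePolytope d P) (hk : 2 ≤ k) (hkd : k + 1 ≤ d)
    (𝒮 : Set (Set (SimplePolytope.Vertex P)))
    (h𝒮 : SimplePolytope.IsSystem (SimplePolytope.graph P) k 𝒮) :
    𝒮 = SimplePolytope.faceVertexSets P k ↔
      ∀ 𝒯 : Set (Set (SimplePolytope.Vertex P)),
        SimplePolytope.IsSystem (SimplePolytope.graph P) k 𝒯 → 𝒯.encard ≤ 𝒮.encard := by
  have := hP.isPolytope.finite_vertex
  refine SimplePolytope.eq_iff_forall_encard_le hP.isSystem_faceVertexSets h𝒮 ?_ ?_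
  · obtain ⟨c, hc⟩ := hP.isPolytope.exists_injective
    exact ⟨_, hP.isPolytope.isObjective c hc⟩
  · rintro _ ⟨F, ⟨hF, hne, -⟩, rfl⟩
    obtain ⟨c, hc, hinit⟩ := hP.isPolytope.exists_injective_initial hF hne
    exact ⟨_, hP.isPolytope.isObjective c hc, fun u hu w hw => hinit u w hu hw⟩
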